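/- Let $G$ be a finite, simple, connected graph drawn in the plane, that is, distinct vertices are represented by distinct points of $\mathbb{R}^2$, every edge by a simple arc joining its two endpoints and passing through no other vertex, and the arcs of two different edges meet only in common endpoints. Let $F$ be the number of regions of the drawing, i.e. the number of connected components of the complement of the drawing in $\mathbb{R}^2$ (the unbounded region included), and let $C(G)$ be the set of induced cycles of $G$, i.e. of the induced subgraphs of $G$ that are cycles (of length at least $3$). If $|C(G)| \le F+2$, then $\chi(G) \le 4$. -/

import Mathlib

/-- The plane `ℝ²`. -/
abbrev Plane : Type := EuclideanSpace ℝ (Fin 2)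

/-- A drawing of a simple graph in the plane: distinct vertices are distinct points, every edge is
a simple arc (the range of an injective path) joining the points of its two endpoints, an arc
passes through no vertex other than its endpoints, and two different arcs meet at most in (the
points of) common endpoints. -/
structure PlaneDrawing {V : Type*} (G : SimpleGraph V) where
  /-- the point that represents a vertex -/
  point : V → Plane
  /-- the set of points of the arc that represents an edge -/
  arc : G.edgeSet → Set Plane
  point_injective : Function.Injective point
  arc_isArc : ∀ (u v : V) (h : G.Adj u v), ∃ γ : Path (point u) (point v),
    Function.Injective γ ∧ Set.range γ = arc ⟨s(u, v), h⟩
  mem_of_point_mem_arc : ∀ (w : V) (e : G.edgeSet), point w ∈ arc e → w ∈ (e : Sym2 V)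
  arc_inter_arc : ∀ e f : G.edgeSet, e ≠ f →
    arc e ∩ arc f ⊆ point '' {v | v ∈ (e : Sym2 V) ∧ v ∈ (f : Sym2 V)}

namespace PlaneDrawing

/-- The set of all points of the plane that lie on the drawing. -/
def support {V : Type*} {G : SimpleGraph V} (D : PlaneDrawing G) : Set Plane :=
  Set.range D.point ∪ ⋃ e, D.arc e

/-- The number of regions of a drawing (the unbounded one included): the number of connected
components of the complement of the drawing in the plane. -/
noncomputable def numRegions {V : Type*} {G : SimpleGraph V} (D : PlaneDrawing G) : ℕ :=
  Nat.card (ConnectedComponents ↥(D.support)ᶜ)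

end PlaneDrawing

namespace SimpleGraph

/-- The set of induced cycles of `G`: the induced subgraphs of `G` that are isomorphic to a cycle
of some length `n ≥ 3` (triangles included). -/
def inducedCycles {V : Type*} (G : SimpleGraph V) : Set G.Subgraph :=
  {H | H.IsInduced ∧ ∃ n : ℕ, 3 ≤ n ∧ Nonempty (H.coe ≃g SimpleGraph.cycleGraph n)}

end SimpleGraph

/-! Let `E`, `V` be the numbers of edges and vertices. Two estimates are played against each other:
a connected graph that is not 4-colourable has at least `E - V + 5` induced cycles, and a plane
drawing has `F ≤ E - V + 2` regions. With `|C(G)| ≤ F + 2` these give `E - V + 5 ≤ E - V + 4`.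

For the first, compare the number of induced cycles with the Betti number `E - V + 1`; their
difference is `excess`. Delete a non-cut vertex `v` of degree `d`. The Betti number drops by `d -
1`. Each pair of linked neighbours of `v` gives its own induced cycle through `v`, and the graph of
linked pairs is connected, so at least `d - 1` cycles disappear; the excess never grows. If `k + 1`
neighbours are pairwise linked, the link graph has at least `k.choose 2` edges more than a spanning
tree, and the excess drops by that much. Minimum degree `k + 1` provides such a `v`
(`exists_linked_clique`). A graph that is not 4-colourable has a connected induced subgraph of
minimum degree 4: deleting one vertex costs 3, minimum degree 3 remains, and the next deletion costs
1, so the excess is at least 4 (`four_le_excess`).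

The second is half of Euler's formula, proved with logarithms instead of the Jordan curve theorem.
For one point `p i` in each bounded region, no nontrivial product of powers of the functions `z - p
i` has a continuous logarithm on the drawing (Eilenberg's criterion, `eq_zero_of_exp_eq_prod_zpow`),
whereas linear algebra over `ℤ` yields such a product as soon as there are more than `E - V + 1`
points (`exists_exp_eq_prod_zpow`). -/

namespace SimpleGraph

variable {V : Type*} {G : SimpleGraph V}

/-! ### Induced cycles through a vertex and the link graph -/

/-- A shortest path, as a sequence of vertices: it is injective and has no chords. -/
lemma Connected.exists_geodesic (hG : G.Connected) (x y : V) :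
    ∃ (l : ℕ) (f : ℕ → V), f 0 = x ∧ f l = y ∧ (∀ i < l, G.Adj (f i) (f (i + 1))) ∧
      ∀ i j, i < j → j ≤ l → f i ≠ f j ∧ (G.Adj (f i) (f j) → j = i + 1) := by
  obtain ⟨p, hp⟩ := hG.exists_walk_length_eq_dist x y
  have key : ∀ i j, i < j → j ≤ p.length → j - i ≤ G.dist (p.getVert i) (p.getVert j) := by
    intro i j hij hj
    have h1 := G.dist_le (p.take i)
    have h2 := G.dist_le (p.drop j)
    have h3 := hG.dist_triangle (u := x) (v := p.getVert i) (w := y)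
    have h4 := hG.dist_triangle (u := p.getVert i) (v := p.getVert j) (w := y)
    simp only [Walk.take_length, Walk.drop_length] at h1 h2
    omega
  refine ⟨p.length, p.getVert, by simp, by simp, fun i hi => p.adj_getVert_succ hi, ?_⟩
  intro i j hij hj
  have := key i j hij hj
  refine ⟨fun h => ?_, fun h => ?_⟩
  · rw [h, dist_self] at this
    omega
  · rw [dist_eq_one_iff_adj.2 h] at this
    omega

lemma induce_singleton_connected (x : V) : (G.induce {x}).Connected :=
  have : Nonempty ({x} : Set V) := ⟨⟨x, rfl⟩⟩
  have : Subsingleton ({x} : Set V) := Set.subsingleton_singleton.coe_sort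
  ⟨Preconnected.of_subsingleton⟩

/-- The vertex sets of the induced cycles of a graph. -/
def cycleSets (G : SimpleGraph V) : Set (Set V) :=
  {A | ∃ n : ℕ, 3 ≤ n ∧ Nonempty (G.induce A ≃g cycleGraph n)}

/-- The vertices `x` and `y` are the only neighbours of `v` in some connected set of vertices. -/
def Linked (G : SimpleGraph V) (W : Set V) (v x y : V) : Prop :=
  x ≠ y ∧ ∃ T ⊆ W, x ∈ T ∧ y ∈ T ∧ v ∉ T ∧ (∀ z ∈ T, G.Adj v z ↔ z = x ∨ z = y) ∧
    (G.induce T).Preconnected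

lemma Linked.symm {W : Set V} {v x y : V} (h : G.Linked W v x y) : G.Linked W v y x := by
  obtain ⟨hne, T, hT, hx, hy, hv, hz, hc⟩ := h
  exact ⟨hne.symm, T, hT, hy, hx, hv, fun z hzT => by rw [hz z hzT, or_comm], hc⟩

lemma Linked.mono {W W' : Set V} {v x y : V} (h : G.Linked W v x y) (hW : W ⊆ W') :
    G.Linked W' v x y := by
  obtain ⟨hne, T, hT, h⟩ := h
  exact ⟨hne, T, hT.trans hW, h⟩

lemma cycleGraph_adj_of_lt {n : ℕ} {i j : Fin n} (hij : i < j) :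
    (cycleGraph n).Adj i j ↔ j.val = i.val + 1 ∨ (i.val = 0 ∧ j.val + 1 = n) := by
  have hi := i.2
  have hj := j.2
  have hij' : i.val < j.val := hij
  rw [cycleGraph_adj', Fin.sub_val_of_le hij.le]
  have : (i - j).val = n - j.val + i.val := by
    rw [Fin.sub_def]
    exact Nat.mod_eq_of_lt (by omega)
  rw [this]
  omega

/-- A geodesic from `x` to `y` inside the connected set `T` has no chords, and `v` sees only its two
ends, so adding `v` closes it to an induced cycle. -/
lemma Linked.exists_cycleSet {W : Set V} {v x y : V} (h : G.Linked W v x y) (hv : v ∈ W) :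
    ∃ A ∈ G.cycleSets, A ⊆ W ∧ v ∈ A ∧ x ∈ A ∧ y ∈ A ∧ ∀ z ∈ A, G.Adj v z → z = x ∨ z = y := by
  obtain ⟨hne, T, hTW, hxT, hyT, hvT, hz, hc⟩ := h
  have hconn : (G.induce T).Connected := @Connected.mk _ _ hc ⟨⟨x, hxT⟩⟩
  obtain ⟨l, g, hg0, hgl, hadj, hg⟩ := hconn.exists_geodesic ⟨x, hxT⟩ ⟨y, hyT⟩
  have hl : l ≠ 0 := by
    rintro rfl
    exact hne (congrArg Subtype.val (hg0.symm.trans hgl))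
  -- Positions `0, …, l` run along the geodesic and position `l + 1` is `v`; since `l ≥ 1`, the
  -- length `l + 2` is at least 3.
  let F : Fin (l + 2) → V := fun i => if i.val ≤ l then (g i.val).1 else v
  have hF : ∀ i : Fin (l + 2), i.val ≤ l → F i = (g i.val).1 := fun i hi => if_pos hi
  have hF' : ∀ i : Fin (l + 2), i.val = l + 1 → F i = v := fun i hi => if_neg (by omega)
  have hvadj : ∀ i ≤ l, G.Adj v (g i).1 ↔ i = 0 ∨ i = l := by
    intro i hi
    rw [hz _ (g i).2]
    constructor
    · rintro (h | h)
      · left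
        by_contra h0
        exact (hg 0 i (by omega) hi).1 (hg0.trans (Subtype.ext h.symm))
      · right
        by_contra h0
        exact (hg i l (by omega) le_rfl).1 ((Subtype.ext h : g i = ⟨y, hyT⟩).trans hgl.symm)
    · rintro (rfl | rfl)
      · left; rw [hg0]
      · right; rw [hgl]
  have hlt : ∀ i j : Fin (l + 2), i < j → F i ≠ F j ∧
      (G.Adj (F i) (F j) ↔ (cycleGraph (l + 2)).Adj i j) := by
    intro i j hij
    have hij' : i.val < j.val := hij
    have hj := j.2
    rw [cycleGraph_adj_of_lt hij]
    by_cases hjl : j.val ≤ l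
    · rw [hF i (by omega), hF j hjl]
      refine ⟨fun h => (hg i j hij' hjl).1 (Subtype.ext h), fun h => ?_, ?_⟩
      · exact Or.inl ((hg i j hij' hjl).2 h)
      · rintro (h | h)
        · rw [h]
          exact hadj i.val (by omega)
        · omega
    · rw [hF i (by omega), hF' j (by omega), G.adj_comm, hvadj _ (by omega)]
      refine ⟨fun h => hvT (h ▸ (g i).2), by omega⟩
  have hinj : Function.Injective F := by
    intro i j h
    rcases lt_trichotomy i j with hij | hij | hij
    · exact absurd h (hlt i j hij).1
    · exact hij
    · exact absurd h.symm (hlt j i hij).1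
  have hrel : ∀ i j, G.Adj (F i) (F j) ↔ (cycleGraph (l + 2)).Adj i j := by
    intro i j
    rcases lt_trichotomy i j with hij | rfl | hij
    · exact (hlt i j hij).2
    · simp
    · rw [G.adj_comm, (cycleGraph (l + 2)).adj_comm]
      exact (hlt j i hij).2
  have hmem : ∀ i ≤ l, (g i).1 ∈ Set.range F := fun i hi =>
    ⟨⟨i, by omega⟩, hF ⟨i, by omega⟩ hi⟩
  have hrange : ∀ z ∈ Set.range F, z = v ∨ z ∈ T := by
    rintro _ ⟨i, rfl⟩
    by_cases hi : i.val ≤ l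
    · right; rw [hF i hi]; exact (g i.val).2
    · left; exact if_neg hi
  refine ⟨Set.range F, ⟨l + 2, by omega, ⟨RelIso.symm ⟨Equiv.ofInjective F hinj, ?_⟩⟩⟩, ?_,
    ⟨Fin.last (l + 1), hF' _ rfl⟩, ?_, ?_, ?_⟩
  · intro i j
    exact hrel i j
  · intro z hzF
    rcases hrange z hzF with rfl | h
    · exact hv
    · exact hTW h
  · simpa [hg0] using hmem 0 (by omega)
  · simpa [hgl] using hmem l le_rfl
  · intro z hzF ha
    rcases hrange z hzF with rfl | h
    · exact absurd ha G.irrefl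
    · exact (hz z h).1 ha

/-- The neighbours of `v` in the set `W`. -/
def nbrs (G : SimpleGraph V) (W : Set V) (v : V) : Set V := {x | x ∈ W ∧ G.Adj v x}

/-- The graph of linked neighbours of `v`. -/
def linkGraph (G : SimpleGraph V) (W : Set V) (v : V) : SimpleGraph (G.nbrs W v) where
  Adj x y := G.Linked W v x y
  symm := ⟨fun _ _ h => h.symm⟩
  loopless := ⟨fun _ h => h.1 rfl⟩

/-- The vertex sets of the induced cycles inside `W`. -/
def cycleSetsIn (G : SimpleGraph V) (W : Set V) : Set (Set V) := {A | A ∈ G.cycleSets ∧ A ⊆ W}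

/-- The edges with both ends in `W`. -/
def edgesIn (G : SimpleGraph V) (W : Set V) : Set (Sym2 V) := {e | e ∈ G.edgeSet ∧ ∀ x ∈ e, x ∈ W}

/-- The cycle built from a linked pair meets the neighbourhood of `v` in exactly that pair, so
different pairs give different cycles, all of them through `v`. -/
lemma ncard_cycleSetsIn_add_le [Finite V] {W : Set V} {v : V} (hv : v ∈ W) :
    (G.cycleSetsIn (W \ {v})).ncard + (G.linkGraph W v).edgeSet.ncard ≤
      (G.cycleSetsIn W).ncard := by
  have h : ∀ e ∈ (G.linkGraph W v).edgeSet, ∃ A ∈ G.cycleSetsIn W, v ∈ A ∧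
      ∀ z : G.nbrs W v, z.1 ∈ A ↔ z ∈ e := by
    intro e
    induction e using Sym2.ind with
    | _ x y =>
      intro he
      obtain ⟨A, hA, hAW, hvA, hx, hy, hz⟩ := Linked.exists_cycleSet ((mem_edgeSet _).1 he) hv
      refine ⟨A, ⟨hA, hAW⟩, hvA, fun z => ?_⟩
      rw [Sym2.mem_iff]
      refine ⟨fun h => (hz z h z.2.2).imp Subtype.ext Subtype.ext, ?_⟩
      rintro (rfl | rfl)
      · exact hx
      · exact hy
  choose! φ hφ hvφ hmem using h
  have hinj : Set.InjOn φ (G.linkGraph W v).edgeSet := by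
    intro e he e' he' h
    refine Sym2.ext fun z => ?_
    rw [← hmem e he, ← hmem e' he', h]
  rw [← hinj.ncard_image, ← Set.ncard_union_eq]
  · refine Set.ncard_le_ncard ?_ (Set.toFinite _)
    rintro A (hA | ⟨e, he, rfl⟩)
    · exact ⟨hA.1, hA.2.trans Set.sdiff_subset⟩
    · exact hφ e he
  · rw [Set.disjoint_right]
    rintro _ ⟨e, he, rfl⟩ h
    exact (h.2 (hvφ e he)).2 rfl

lemma ncard_edgesIn_eq [Finite V] {W : Set V} {v : V} (hv : v ∈ W) :
    (G.edgesIn W).ncard = (G.edgesIn (W \ {v})).ncard + (G.nbrs W v).ncard := by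
  have hinj : Set.InjOn (fun x => s(v, x)) (G.nbrs W v) := fun x _ y _ h => Sym2.congr_right.1 h
  rw [← hinj.ncard_image, ← Set.ncard_union_eq]
  · congr 1
    ext e
    constructor
    · rintro ⟨he, heW⟩
      by_cases hve : v ∈ e
      · right
        obtain ⟨x, rfl⟩ := hve
        exact ⟨x, ⟨heW x (Sym2.mem_mk_right v x), (mem_edgeSet _).1 he⟩, rfl⟩
      · left
        exact ⟨he, fun x hx => ⟨heW x hx, fun h => hve (h ▸ hx)⟩⟩
    · rintro (⟨he, h⟩ | ⟨x, hx, rfl⟩)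
      · exact ⟨he, fun x hx => (h x hx).1⟩
      · refine ⟨(mem_edgeSet _).2 hx.2, fun y hy => ?_⟩
        rcases Sym2.mem_iff.1 hy with rfl | rfl
        · exact hv
        · exact hx.1
  · rw [Set.disjoint_right]
    rintro _ ⟨x, hx, rfl⟩ h
    exact (h.2 v (Sym2.mem_mk_left v x)).2 rfl

/-- Walk from one neighbour of `v` to another while avoiding `v`: consecutive visits to neighbours
of `v` are equal or linked, by the stretch of the walk between them. -/
lemma linkGraph_preconnected {W : Set V} {v : V} (hc : (G.induce (W \ {v})).Preconnected) :
    (G.linkGraph W v).Preconnected := by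
  intro x
  have hxW : ∀ z : G.nbrs W v, z.1 ∈ W \ {v} := fun z => ⟨z.2.1, fun h => G.irrefl (h ▸ z.2.2)⟩
  -- Invariant of the walk: `x'` is the last neighbour of `v` visited, and `T` is the stretch from
  -- `x'` to the current vertex `z`, in which `v` has no other neighbour.
  have key : ∀ z : ↥(W \ {v}), (G.induce (W \ {v})).Reachable ⟨x, hxW x⟩ z →
      ∃ x' : G.nbrs W v, (G.linkGraph W v).Reachable x x' ∧ ∃ T ⊆ W \ {v}, x'.1 ∈ T ∧ z.1 ∈ T ∧
        (∀ w ∈ T, G.Adj v w → w = x'.1) ∧ (G.induce T).Preconnected := by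
    intro z hz
    rw [reachable_iff_reflTransGen] at hz
    induction hz with
    | refl =>
      refine ⟨x, Reachable.refl x, {x.1}, by simpa using hxW x, rfl, rfl, fun w hw _ => hw, ?_⟩
      exact (induce_singleton_connected _).preconnected
    | @tail z z' _ hadj ih =>
      obtain ⟨x', hr, T, hT, hx'T, hzT, huniq, hTc⟩ := ih
      have hadj' : G.Adj z.1 z'.1 := hadj
      have hc' : (G.induce (T ∪ {z'.1})).Connected :=
        connected_induce_union hTc (induce_singleton_connected _).preconnected hzT rfl hadj'
      by_cases hvz : G.Adj v z'.1
      · refine ⟨⟨z'.1, z'.2.1, hvz⟩, ?_, {z'.1}, by simp, rfl, rfl, fun w hw _ => hw,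
          (induce_singleton_connected _).preconnected⟩
        by_cases heq : z'.1 = x'.1
        · have : (⟨z'.1, z'.2.1, hvz⟩ : G.nbrs W v) = x' := Subtype.ext heq
          rw [this]
          exact hr
        · refine hr.trans (Adj.reachable ?_)
          refine ⟨fun h => heq h.symm, T ∪ {z'.1}, ?_, Or.inl hx'T, Or.inr rfl, ?_, ?_,
            hc'.preconnected⟩
          · rintro w (hw | rfl)
            · exact (hT hw).1
            · exact z'.2.1
          · rintro (h | h)
            · exact (hT h).2 rfl
            · exact z'.2.2 h.symm
          · rintro w (hw | rfl)
            · refine ⟨fun h => Or.inl (huniq w hw h), ?_⟩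
              rintro (rfl | rfl)
              · exact x'.2.2
              · exact hvz
            · exact ⟨fun _ => Or.inr rfl, fun _ => hvz⟩
      · refine ⟨x', hr, T ∪ {z'.1}, ?_, Or.inl hx'T, Or.inr rfl, ?_, hc'.preconnected⟩
        · rintro w (hw | rfl)
          · exact hT hw
          · exact z'.2
        · rintro w (hw | rfl) h
          · exact huniq w hw h
          · exact absurd h hvz
  intro y
  obtain ⟨x', hr, T, hT, -, hyT, huniq, -⟩ := key ⟨y, hxW y⟩ (hc _ _)
  have : y = x' := Subtype.ext (huniq y hyT y.2.2)
  rw [this]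
  exact hr

/-- Deleting all edges inside `K` keeps the graph connected, because the star from `h` to `K`
survives; what is left still has at least as many edges as a spanning tree. -/
lemma Connected.card_add_choose_le [Finite V] (hG : G.Connected) {K : Finset V} {h : V} (hK : h ∉ K)
    (hadj : ∀ x ∈ K, G.Adj h x) (hclique : ∀ x ∈ K, ∀ y ∈ K, x ≠ y → G.Adj x y) :
    Nat.card V + K.card.choose 2 ≤ G.edgeSet.ncard + 1 := by
  classical
  let S : Set (Sym2 V) := ((K.offDiag.image Sym2.mk.uncurry : Finset (Sym2 V)) : Set (Sym2 V))
  have hS : S.ncard = K.card.choose 2 := by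
    rw [Set.ncard_coe_finset, Sym2.card_image_offDiag]
  have hSmem : ∀ x y, s(x, y) ∈ S → x ∈ K ∧ y ∈ K ∧ x ≠ y := by
    intro x y hxy
    simp only [S, Finset.coe_image, Set.mem_image, Finset.mem_coe, Finset.mem_offDiag] at hxy
    obtain ⟨⟨a, b⟩, ⟨ha, hb, hab⟩, h⟩ := hxy
    rcases Sym2.eq_iff.1 h with ⟨rfl, rfl⟩ | ⟨rfl, rfl⟩
    · exact ⟨ha, hb, hab⟩
    · exact ⟨hb, ha, hab.symm⟩
  have hSE : S ⊆ G.edgeSet := by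
    intro e
    induction e using Sym2.ind with
    | _ x y =>
      intro he
      obtain ⟨hx, hy, hxy⟩ := hSmem x y he
      exact hclique x hx y hy hxy
  let G' := G.deleteEdges S
  have hhub : ∀ x ∈ K, G'.Adj h x := fun x hx =>
    deleteEdges_adj.2 ⟨hadj x hx, fun hm => hK (hSmem h x hm).1⟩
  have hstep : ∀ x y, G.Adj x y → G'.Reachable x y := by
    intro x y hxy
    by_cases hm : s(x, y) ∈ S
    · obtain ⟨hx, hy, -⟩ := hSmem x y hm
      exact (hhub x hx).symm.reachable.trans (hhub y hy).reachable
    · exact (deleteEdges_adj.2 ⟨hxy, hm⟩ : G'.Adj x y).reachable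
  have hG' : G'.Connected := by
    have := hG.nonempty
    refine ⟨fun x y => ?_⟩
    have := hG.preconnected x y
    rw [reachable_iff_reflTransGen] at this
    induction this with
    | refl => exact Reachable.refl x
    | tail _ hadj ih => exact ih.trans (hstep _ _ hadj)
  have h1 := hG'.card_vert_le_card_edgeSet_add_one
  have h2 : G'.edgeSet.ncard + S.ncard = G.edgeSet.ncard := by
    rw [edgeSet_deleteEdges]
    exact Set.ncard_sdiff_add_ncard_of_subset hSE
  rw [Nat.card_coe_set_eq] at h1
  omega

/-! ### A non-cut vertex with many pairwise linked neighbours -/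

/-- A finite set of vertices in which all degrees are at least `k` has a vertex with `k` pairwise
linked neighbours, which is moreover not a cut vertex. -/
theorem exists_linked_clique [Finite V] (n : ℕ) : ∀ (W : Set V) (k : ℕ), W.ncard = n →
    W.Nonempty → (∀ v ∈ W, k ≤ (G.nbrs W v).ncard) →
    ∃ v ∈ W, (∃ K ⊆ G.nbrs W v, K.ncard = k ∧ ∀ x ∈ K, ∀ y ∈ K, x ≠ y → G.Linked W v x y) ∧
      ((G.induce W).Preconnected → (G.induce (W \ {v})).Preconnected) := by
  induction n using Nat.strong_induction_on with
  | _ n ih =>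
    intro W k hWn hne hdeg
    by_cases hcomp : ∀ x ∈ W, ∀ y ∈ W, x ≠ y → G.Adj x y
    · obtain ⟨v, hv⟩ := hne
      obtain ⟨K, hK, hKk⟩ := Set.exists_subset_card_eq (hdeg v hv)
      refine ⟨v, hv, ⟨K, hK, hKk, fun x hx y hy hxy => ?_⟩, fun _ => ?_⟩
      · refine ⟨hxy, {x, y}, ?_, by simp, by simp, ?_, ?_,
          (induce_pair_connected_of_adj (hcomp x (hK hx).1 y (hK hy).1 hxy)).preconnected⟩
        · rintro z (rfl | rfl)
          · exact (hK hx).1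
          · exact (hK hy).1
        · rintro (rfl | rfl)
          · exact G.irrefl (hK hx).2
          · exact G.irrefl (hK hy).2
        · rintro z (rfl | rfl)
          · simp [(hK hx).2]
          · simp [(hK hy).2]
      · rintro ⟨x, hx⟩ ⟨y, hy⟩
        by_cases hxy : x = y
        · subst hxy; exact Reachable.refl _
        · exact Adj.reachable (hcomp x hx.1 y hy.1 hxy : G.Adj x y)
    · push Not at hcomp
      obtain ⟨a, ha, b, hb, hab, hnadj⟩ := hcomp
      -- Take `D` of maximal size among the connected sets that miss some vertex together with its
      -- whole neighbourhood. Let `S` be the boundary of `D` and `R` the rest of `W`. Maximality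
      -- makes `R` completely joined to `S`: a vertex of `S` not adjacent to some `r ∈ R` could be
      -- added to `D`.
      let P : Set (Set V) := {D | D ⊆ W ∧ (G.induce D).Connected ∧
        ∃ v ∈ W, v ∉ D ∧ ∀ z ∈ D, ¬ G.Adj v z}
      have hPne : P.Nonempty := by
        refine ⟨{a}, by simpa using ha, induce_singleton_connected _, b, hb,
          by simpa using hab.symm, ?_⟩
        rintro z rfl h
        exact hnadj h.symm
      obtain ⟨D, ⟨hDW, hDc, v, hvW, hvD, hvn⟩, hmax⟩ :=
        (Set.toFinite P).exists_maximalFor Set.ncard P hPne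
      let S : Set V := {s | s ∈ W ∧ s ∉ D ∧ ∃ z ∈ D, G.Adj s z}
      let R : Set V := {r | r ∈ W ∧ r ∉ D ∧ ∀ z ∈ D, ¬ G.Adj r z}
      have hRW : R ⊆ W := fun r hr => hr.1
      have hcompl : ∀ r ∈ R, ∀ s ∈ S, G.Adj r s := by
        intro r hr s hs
        by_contra hrs
        obtain ⟨z, hz, hsz⟩ := hs.2.2
        have hD' : D ∪ {s} ∈ P := by
          refine ⟨Set.union_subset hDW (by simpa using hs.1), connected_induce_union hDc.preconnected
            (induce_singleton_connected _ : (G.induce {s}).Connected).preconnected hz rfl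
            hsz.symm, r, hr.1, ?_, ?_⟩
          · rintro (h | rfl)
            · exact hr.2.1 h
            · exact hr.2.2 z hz hsz
          · rintro w (hw | rfl)
            · exact hr.2.2 w hw
            · exact hrs
        have h1 := hmax hD' (Set.ncard_le_ncard Set.subset_union_left)
        have h2 : D.ncard < (D ∪ {s}).ncard :=
          Set.ncard_lt_ncard (Set.ssubset_iff_subset_ne.2 ⟨Set.subset_union_left, fun h =>
            hs.2.1 (h ▸ Or.inr rfl)⟩)
        exact absurd h1 (not_le.2 h2)
      have hSR : ∀ r ∈ R, G.nbrs W r = G.nbrs R r ∪ S := by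
        intro r hr
        ext x
        constructor
        · rintro ⟨hx, hrx⟩
          have hxD : x ∉ D := fun h => hr.2.2 x h hrx
          by_cases h : ∃ z ∈ D, G.Adj x z
          · exact Or.inr ⟨hx, hxD, h⟩
          · push Not at h
            exact Or.inl ⟨⟨hx, hxD, h⟩, hrx⟩
        · rintro (⟨hx, hrx⟩ | hx)
          · exact ⟨hx.1, hrx⟩
          · exact ⟨hx.1, hcompl r hr x hx⟩
      have hSRdisj : ∀ x ∈ R, x ∉ S := fun x hx hxS => by
        obtain ⟨z, hz, h⟩ := hxS.2.2
        exact hx.2.2 z hz h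
      obtain ⟨z₀, hz₀⟩ : D.Nonempty := Set.nonempty_coe_sort.1 hDc.nonempty
      have hRlt : R.ncard < n := by
        rw [← hWn]
        exact Set.ncard_lt_ncard (Set.ssubset_iff_subset_ne.2 ⟨hRW, fun h =>
          (h ▸ hDW hz₀ : z₀ ∈ R).2.1 hz₀⟩)
      have hRdeg : ∀ r ∈ R, k - S.ncard ≤ (G.nbrs R r).ncard := by
        intro r hr
        have h1 := hdeg r hr.1
        rw [hSR r hr] at h1
        have h2 := Set.ncard_union_le (G.nbrs R r) S
        omega
      -- Induction inside `R`, where degrees have dropped by at most `|S|`; truncated subtraction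
      -- covers `|S| ≥ k`. The non-cut clause for `R` is discarded and proved afresh for `W`.
      obtain ⟨r, hr, ⟨K, hKR, hKcard, hK⟩, -⟩ := ih R.ncard hRlt R (k - S.ncard) rfl
        ⟨v, hvW, hvD, hvn⟩ hRdeg
      have hKS : Disjoint K S := Set.disjoint_left.2 fun x hx => hSRdisj x (hKR hx).1
      have hsub : K ∪ S ⊆ G.nbrs W r := by
        rw [hSR r hr]
        exact Set.union_subset_union_left S hKR
      have hlinkRS : ∀ x ∈ K, ∀ y ∈ S, G.Linked W r x y := by
        intro x hx y hy
        refine ⟨fun h => hSRdisj x (hKR hx).1 (h ▸ hy), {x, y}, ?_, by simp, by simp, ?_, ?_,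
          (induce_pair_connected_of_adj (hcompl x (hKR hx).1 y hy)).preconnected⟩
        · rintro z (rfl | rfl)
          · exact (hKR hx).1.1
          · exact hy.1
        · rintro (rfl | rfl)
          · exact G.irrefl (hKR hx).2
          · exact hSRdisj _ hr hy
        · rintro z (rfl | rfl)
          · simp [(hKR hx).2]
          · simp [hcompl r hr _ hy]
      -- Pairs in `K` are linked by induction, mixed pairs because they are adjacent, and pairs in
      -- `S` through `D`, where `r` has no neighbour.
      have hlink : ∀ x ∈ K ∪ S, ∀ y ∈ K ∪ S, x ≠ y → G.Linked W r x y := by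
        rintro x (hx | hx) y (hy | hy) hxy
        · exact (hK x hx y hy hxy).mono hRW
        · exact hlinkRS x hx y hy
        · exact (hlinkRS y hy x hx).symm
        · obtain ⟨z, hz, hxz⟩ := hx.2.2
          obtain ⟨w, hw, hyw⟩ := hy.2.2
          have h1 : (G.induce (D ∪ {x})).Connected := connected_induce_union hDc.preconnected
            (induce_singleton_connected _ : (G.induce {x}).Connected).preconnected hz rfl
            hxz.symm
          have h2 : (G.induce (D ∪ {x} ∪ {y})).Connected := connected_induce_union h1.preconnected
            (induce_singleton_connected _ : (G.induce {y}).Connected).preconnected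
            (Or.inl hw) rfl hyw.symm
          refine ⟨hxy, D ∪ {x} ∪ {y}, ?_, Or.inl (Or.inr rfl), Or.inr rfl, ?_, ?_,
            h2.preconnected⟩
          · rintro w ((hw | rfl) | rfl)
            · exact hDW hw
            · exact hx.1
            · exact hy.1
          · rintro ((h | rfl) | rfl)
            · exact hr.2.1 h
            · exact hSRdisj _ hr hx
            · exact hSRdisj _ hr hy
          · rintro w ((hw | rfl) | rfl)
            · refine ⟨fun h => absurd h (hr.2.2 w hw), ?_⟩
              rintro (rfl | rfl)
              · exact absurd hw hx.2.1
              · exact absurd hw hy.2.1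
            · simp [hcompl r hr _ hx]
            · simp [hcompl r hr _ hy]
      refine ⟨r, hr.1, ?_, ?_⟩
      · obtain ⟨K', hK', hK'k⟩ := Set.exists_subset_card_eq (s := K ∪ S) (n := k) (by
          rw [Set.ncard_union_eq hKS]; omega)
        exact ⟨K', hK'.trans hsub, hK'k, fun x hx y hy => hlink x (hK' hx) y (hK' hy)⟩
      · intro hWc
        -- Without `S`, the set `D` would be cut off from `v`. A vertex of `S` then joins `D` to all
        -- of `R`, so removing `r` disconnects nothing.
        have hSne : S.Nonempty := by
          by_contra hS
          have hS' : ∀ x ∈ W, x ∉ D → ∀ z ∈ D, ¬ G.Adj x z := fun x hx hxD z hz h =>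
            hS ⟨x, hx, hxD, z, hz, h⟩
          have hreach := hWc ⟨z₀, hDW hz₀⟩ ⟨v, hvW⟩
          rw [reachable_iff_reflTransGen] at hreach
          have : ∀ w : W, Relation.ReflTransGen (G.induce W).Adj ⟨z₀, hDW hz₀⟩ w → w.1 ∈ D := by
            intro w hw
            induction hw with
            | refl => exact hz₀
            | @tail b c _ hadj ih' =>
              by_contra hc
              exact hS' c.1 c.2 hc b.1 ih' (show G.Adj b.1 c.1 from hadj).symm
          exact hvD (this _ hreach)
        obtain ⟨s, hs⟩ := hSne
        have hrD : D ⊆ W \ {r} := fun z hz => ⟨hDW hz, fun h => hr.2.1 (h ▸ hz)⟩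
        have hsr : s ∈ W \ {r} := ⟨hs.1, fun h => hSRdisj r hr (h ▸ hs)⟩
        have hSz : ∀ x (hx : x ∈ W \ {r}), x ∈ S →
            (G.induce (W \ {r})).Reachable ⟨z₀, hrD hz₀⟩ ⟨x, hx⟩ := by
          intro x hx hxS
          obtain ⟨z, hz, hxz⟩ := hxS.2.2
          have h1 : (G.induce (W \ {r})).Reachable ⟨z₀, hrD hz₀⟩ ⟨z, hrD hz⟩ :=
            (hDc.preconnected ⟨z₀, hz₀⟩ ⟨z, hz⟩).map (induceHomOfLE G hrD).toHom
          exact h1.trans (Adj.reachable (show G.Adj z x from hxz.symm))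
        have hall : ∀ x (hx : x ∈ W \ {r}),
            (G.induce (W \ {r})).Reachable ⟨z₀, hrD hz₀⟩ ⟨x, hx⟩ := by
          intro x hx
          by_cases hxD : x ∈ D
          · exact (hDc.preconnected ⟨z₀, hz₀⟩ ⟨x, hxD⟩).map (induceHomOfLE G hrD).toHom
          by_cases hxS : x ∈ S
          · exact hSz x hx hxS
          · have hxR : x ∈ R := ⟨hx.1, hxD, fun z hz h => hxS ⟨hx.1, hxD, z, hz, h⟩⟩
            exact (hSz s hsr hs).trans (Adj.reachable (show G.Adj s x from
              (hcompl x hxR s hs).symm))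
        exact fun x y => (hall x x.2).symm.trans (hall y y.2)

end SimpleGraph

/-! ### Excess of induced cycles over the Betti number -/

namespace SimpleGraph

variable {V : Type*} {G : SimpleGraph V}

/-- The number of induced cycles inside `W` in excess of the first Betti number that the subgraph
induced on `W` has if it is connected. -/
noncomputable def excess (G : SimpleGraph V) (W : Set V) : ℤ :=
  (G.cycleSetsIn W).ncard + W.ncard - (G.edgesIn W).ncard - 1

/-- One element of `K` serves as the hub of a star and the other `k` contribute `k.choose 2` surplus
edges of the link graph, hence surplus cycles through `v`. -/
lemma excess_diff_singleton_add_le [Finite V] {W : Set V} {v : V} (hv : v ∈ W)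
    (hc : (G.induce (W \ {v})).Preconnected) {K : Set V} {k : ℕ} (hK : K ⊆ G.nbrs W v)
    (hKk : K.ncard = k + 1) (hlink : ∀ x ∈ K, ∀ y ∈ K, x ≠ y → G.Linked W v x y) :
    G.excess (W \ {v}) + k.choose 2 ≤ G.excess W := by
  classical
  obtain ⟨h, hh⟩ : K.Nonempty := Set.nonempty_of_ncard_ne_zero (by omega)
  have hconn : (G.linkGraph W v).Connected :=
    @Connected.mk _ _ (linkGraph_preconnected hc) ⟨⟨h, hK hh⟩⟩
  let K₀ : Set (G.nbrs W v) := Subtype.val ⁻¹' (K \ {h})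
  have hfin : K₀.Finite := Set.toFinite _
  have hK₀ : hfin.toFinset.card = k := by
    rw [← Set.ncard_eq_toFinset_card K₀ hfin,
      Set.ncard_preimage_of_injective_subset_range Subtype.val_injective
        (by rw [Subtype.range_coe]; exact Set.sdiff_subset.trans hK),
      Set.ncard_sdiff_singleton_of_mem hh, hKk, Nat.add_sub_cancel]
  have h1 := hconn.card_add_choose_le (K := hfin.toFinset) (h := ⟨h, hK hh⟩)
    (by simp [K₀])
    (fun x hx => by
      have hx' : x ∈ K₀ := hfin.mem_toFinset.1 hx
      exact hlink h hh x hx'.1 (fun e => hx'.2 e.symm))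
    (fun x hx y hy hxy => by
      have hx' : x ∈ K₀ := hfin.mem_toFinset.1 hx
      have hy' : y ∈ K₀ := hfin.mem_toFinset.1 hy
      exact hlink x hx'.1 y hy'.1 (fun e => hxy (Subtype.ext e)))
  have h2 := ncard_cycleSetsIn_add_le (G := G) hv
  have h3 := ncard_edgesIn_eq (G := G) hv
  have h4 : (W \ {v}).ncard + 1 = W.ncard := Set.ncard_sdiff_singleton_add_one hv
  rw [hK₀, Nat.card_coe_set_eq] at h1
  unfold excess
  omega

/-- `B` is reached from `A` by adding one adjacent vertex at a time; each addition reverses the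
deletion of a non-cut vertex, used with `k = 0`. -/
lemma excess_mono [Finite V] (n : ℕ) : ∀ {A B : Set V}, (B \ A).ncard = n → A ⊆ B →
    (G.induce A).Connected → (G.induce B).Connected → G.excess A ≤ G.excess B := by
  induction n with
  | zero =>
    intro A B hn hAB hA hB
    rw [Set.ncard_eq_zero, Set.sdiff_eq_empty] at hn
    rw [hAB.antisymm hn]
  | succ n ih =>
    intro A B hn hAB hA hB
    obtain ⟨a, ha⟩ := Set.nonempty_coe_sort.1 hA.nonempty
    obtain ⟨u, huB, huA, z, hz, hzu⟩ : ∃ u ∈ B, u ∉ A ∧ ∃ z ∈ A, G.Adj z u := by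
      by_contra! hno
      obtain ⟨b, hb⟩ : (B \ A).Nonempty := Set.nonempty_of_ncard_ne_zero (by omega)
      have hreach := hB.preconnected ⟨a, hAB ha⟩ ⟨b, hb.1⟩
      rw [reachable_iff_reflTransGen] at hreach
      have : ∀ w : B, Relation.ReflTransGen (G.induce B).Adj ⟨a, hAB ha⟩ w → w.1 ∈ A := by
        intro w hw
        induction hw with
        | refl => exact ha
        | @tail b c _ hadj ih' =>
          by_contra hc
          exact hno c.1 c.2 hc b.1 ih' hadj
      exact hb.2 (this _ hreach)
    have hAu : (G.induce (A ∪ {u})).Connected := connected_induce_union hA.preconnected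
      (induce_singleton_connected u).preconnected hz rfl hzu
    have hdiff : (A ∪ {u}) \ {u} = A := by
      ext x
      constructor
      · rintro ⟨h | h, h'⟩
        · exact h
        · exact absurd h h'
      · exact fun h => ⟨Or.inl h, fun e => huA (e ▸ h)⟩
    have h1 : G.excess A ≤ G.excess (A ∪ {u}) := by
      have := excess_diff_singleton_add_le (G := G) (W := A ∪ {u}) (v := u) (K := {z}) (k := 0)
        (Or.inr rfl) (by rw [hdiff]; exact hA.preconnected)
        (by simpa [nbrs] using ⟨Or.inr hz, hzu.symm⟩) (by simp)
        (by rintro x rfl y rfl h; exact absurd rfl h)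
      rw [hdiff] at this
      simpa using this
    refine h1.trans (ih ?_ ?_ hAu hB)
    · have : B \ (A ∪ {u}) = (B \ A) \ {u} := by
        ext x; simp [and_assoc, and_comm]
      rw [this, Set.ncard_sdiff_singleton_of_mem (show u ∈ B \ A from ⟨huB, huA⟩), hn, Nat.add_sub_cancel]
    · exact Set.union_subset hAB (by simpa using huB)

lemma excess_nonneg [Finite V] {W : Set V} (hW : (G.induce W).Connected) : 0 ≤ G.excess W := by
  obtain ⟨a, ha⟩ := Set.nonempty_coe_sort.1 hW.nonempty
  refine le_trans ?_ (excess_mono _ rfl (Set.singleton_subset_iff.2 ha)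
    (induce_singleton_connected a) hW)
  have : G.edgesIn {a} = ∅ := by
    rw [Set.eq_empty_iff_forall_notMem]
    intro e
    induction e using Sym2.ind with
    | _ x y =>
      rintro ⟨he, h⟩
      have hx : x = a := h x (Sym2.mem_mk_left x y)
      have hy : y = a := h y (Sym2.mem_mk_right x y)
      subst hx hy
      exact G.irrefl ((mem_edgeSet _).1 he)
  simp [excess, this]

lemma excess_of_minDegree [Finite V] {W : Set V} {k : ℕ} (hW : (G.induce W).Connected)
    (hdeg : ∀ v ∈ W, k + 1 ≤ (G.nbrs W v).ncard) :
    ∃ v ∈ W, (G.induce (W \ {v})).Preconnected ∧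
      G.excess (W \ {v}) + k.choose 2 ≤ G.excess W := by
  obtain ⟨v, hv, ⟨K, hK, hKk, hlink⟩, hc⟩ := exists_linked_clique _ W (k + 1) rfl
    (Set.nonempty_coe_sort.1 hW.nonempty) hdeg
  exact ⟨v, hv, hc hW.preconnected,
    excess_diff_singleton_add_le hv (hc hW.preconnected) hK hKk hlink⟩

lemma nonempty_diff_singleton [Finite V] {W : Set V} {v : V} (h : 1 ≤ (G.nbrs W v).ncard) :
    (W \ {v}).Nonempty := by
  obtain ⟨x, hx⟩ : (G.nbrs W v).Nonempty := Set.nonempty_of_ncard_ne_zero (by omega)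
  exact ⟨x, hx.1, fun e => G.irrefl (e ▸ hx.2)⟩

lemma one_le_excess [Finite V] {W : Set V} (hW : (G.induce W).Connected)
    (hdeg : ∀ v ∈ W, 3 ≤ (G.nbrs W v).ncard) : 1 ≤ G.excess W := by
  obtain ⟨v, hv, hc, h⟩ := excess_of_minDegree (k := 2) hW hdeg
  have hne := nonempty_diff_singleton (le_trans (by norm_num) (hdeg v hv))
  have := excess_nonneg (G := G) (@Connected.mk _ _ hc hne.to_subtype)
  norm_num at h
  omega

/-- The first deletion gains `Nat.choose 3 2 = 3` and lowers degrees by at most 1, so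
`one_le_excess` applies to the remainder. -/
lemma four_le_excess [Finite V] {W : Set V} (hW : (G.induce W).Connected)
    (hdeg : ∀ v ∈ W, 4 ≤ (G.nbrs W v).ncard) : 4 ≤ G.excess W := by
  obtain ⟨v, hv, hc, h⟩ := excess_of_minDegree (k := 3) hW hdeg
  have hne := nonempty_diff_singleton (le_trans (by norm_num) (hdeg v hv))
  have := one_le_excess (G := G) (@Connected.mk _ _ hc hne.to_subtype) (fun u hu => by
    have h1 := hdeg u hu.1
    have h2 : G.nbrs W u ⊆ G.nbrs (W \ {v}) u ∪ {v} := by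
      intro x hx
      by_cases hxv : x = v
      · exact Or.inr hxv
      · exact Or.inl ⟨⟨hx.1, hxv⟩, hx.2⟩
    have h3 := Set.ncard_le_ncard h2 (Set.toFinite _)
    have h4 := Set.ncard_union_le (G.nbrs (W \ {v}) u) {v}
    rw [Set.ncard_singleton] at h4
    omega)
  have h3 : Nat.choose 3 2 = 3 := rfl
  rw [h3] at h
  push_cast at h
  omega

/-! ### Colourings and the lower bound on induced cycles -/

/-- A graph that has no colouring with `n` colours contains a connected induced subgraph of minimum
degree at least `n`. -/
lemma exists_connected_of_not_colorable [Finite V] {n : ℕ} (hG : ¬ G.Colorable n) :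
    ∃ W : Set V, (G.induce W).Connected ∧ ∀ v ∈ W, n ≤ (G.nbrs W v).ncard := by
  classical
  let P : Set (Set V) := {W | ¬ (G.induce W).Colorable n}
  have hP : P.Nonempty := ⟨Set.univ, fun h => hG (h.of_hom (induceUnivIso G).symm.toHom)⟩
  -- In a minimal set that is not `n`-colourable, separate components could be coloured
  -- independently, and a vertex with fewer than `n` neighbours could be coloured last.
  obtain ⟨W, hW, hmin⟩ := (Set.toFinite P).exists_minimal hP
  have hcol : ∀ W', W' ⊆ W → W' ≠ W → (G.induce W').Colorable n := by
    intro W' hW' hne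
    by_contra h
    exact hne (hW'.antisymm (hmin h hW'))
  have hne : W.Nonempty := by
    by_contra h
    rw [Set.not_nonempty_iff_eq_empty] at h
    subst h
    have : IsEmpty (∅ : Set V) := Set.isEmpty_coe_sort.2 rfl
    exact hW (Colorable.of_isEmpty n)
  refine ⟨W, @Connected.mk _ _ ?_ hne.to_subtype, ?_⟩
  · by_contra hpre
    apply hW
    rw [colorable_iff_forall_connectedComponent]
    intro c
    have hsub : Subtype.val '' c.supp ⊆ W := by
      rintro _ ⟨x, -, rfl⟩
      exact x.2
    have hc := hcol (Subtype.val '' c.supp) hsub (by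
      intro h
      apply hpre
      intro x y
      have hx : ∀ x : W, (G.induce W).connectedComponentMk x = c := by
        intro x
        obtain ⟨x', hx', he⟩ := (h.symm.subset x.2 : x.1 ∈ Subtype.val '' c.supp)
        rw [← Subtype.ext he]
        exact hx'
      exact ConnectedComponent.exact ((hx x).trans (hx y).symm))
    exact hc.of_hom (⟨fun x => ⟨x.1.1, x.1, x.2, rfl⟩, fun h => h⟩ : c.toSimpleGraph →g _)
  · intro v hv
    by_contra! hlt
    obtain ⟨c⟩ := hcol (W \ {v}) Set.sdiff_subset (fun h => (h.symm.subset hv).2 rfl)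
    let col : V → Fin n := fun x => if hx : x ∈ W \ {v} then c ⟨x, hx⟩ else ⟨0, by omega⟩
    have hcard : (col '' G.nbrs W v).ncard < n :=
      (Set.ncard_image_le (Set.toFinite _)).trans_lt hlt
    obtain ⟨a, ha⟩ : ∃ a, a ∉ col '' G.nbrs W v := by
      by_contra! h
      rw [Set.eq_univ_of_forall h, Set.ncard_univ] at hcard
      simp at hcard
    apply hW
    refine ⟨Coloring.mk (fun x => if x.1 = v then a else col x.1) ?_⟩
    rintro ⟨x, hx⟩ ⟨y, hy⟩ hxy
    have hxy' : G.Adj x y := hxy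
    by_cases hxv : x = v
    · subst hxv
      have hyx : y ≠ x := hxy'.ne'
      simp only [if_true, hyx, if_false]
      rintro rfl
      exact ha ⟨y, ⟨hy, hxy'⟩, rfl⟩
    · by_cases hyv : y = v
      · subst hyv
        simp only [if_true, hxv, if_false]
        rintro rfl
        exact ha ⟨x, ⟨hx, hxy'.symm⟩, rfl⟩
      · simp only [hxv, hyv, if_false]
        have hx' : x ∈ W \ {v} := ⟨hx, hxv⟩
        have hy' : y ∈ W \ {v} := ⟨hy, hyv⟩
        simp only [col, dif_pos hx', dif_pos hy']
        exact c.valid hxy'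

lemma ncard_cycleSets_le_ncard_inducedCycles [Finite V] :
    G.cycleSets.ncard ≤ G.inducedCycles.ncard := by
  refine Set.ncard_le_ncard_of_injOn (fun A => (⊤ : G.Subgraph).induce A) ?_ ?_ (Set.toFinite _)
  · rintro A ⟨n, hn, h⟩
    refine ⟨?_, n, hn, ?_⟩
    · intro a ha b hb hab
      exact ⟨ha, hb, hab⟩
    · rwa [induce_eq_coe_induce_top] at h
  · intro A _ B _ h
    exact congrArg Subgraph.verts h

/-- A connected graph that is not 4-colourable has many induced cycles. -/
theorem ncard_edgeSet_add_five_le [Finite V] (hG : G.Connected) (hcol : ¬ G.Colorable 4) :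
    G.edgeSet.ncard + 5 ≤ G.inducedCycles.ncard + Nat.card V := by
  obtain ⟨W, hW, hdeg⟩ := exists_connected_of_not_colorable hcol
  have huniv : (G.induce Set.univ).Connected := (Iso.connected_iff (induceUnivIso G)).2 hG
  have h := (four_le_excess hW hdeg).trans (excess_mono _ rfl (Set.subset_univ W) hW huniv)
  have h1 : G.cycleSetsIn Set.univ = G.cycleSets := by ext; simp [cycleSetsIn]
  have h2 : G.edgesIn Set.univ = G.edgeSet := by ext; simp [edgesIn]
  have h3 := ncard_cycleSets_le_ncard_inducedCycles (G := G)
  rw [excess, h1, h2, Set.ncard_univ] at h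
  omega

end SimpleGraph

/-! ### Continuous logarithms and Eilenberg's criterion -/

/-- A continuous function without zeros on a simply connected space has a continuous logarithm. -/
lemma exists_continuousMap_exp_eq {X : Type*} [TopologicalSpace X] [SimplyConnectedSpace X]
    [LocallyPathConnectedSpace X] {f : X → ℂ} (hf : Continuous f) (h0 : ∀ x, f x ≠ 0) :
    ∃ g : C(X, ℂ), ∀ x, Complex.exp (g x) = f x := by
  obtain ⟨x₀⟩ : Nonempty X := inferInstance
  obtain ⟨g, ⟨-, hg⟩, -⟩ := Complex.isCoveringMapOn_exp.existsUnique_continuousMap_lifts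
    ⟨f, hf⟩ (Complex.exp_log (h0 x₀)) (fun x => h0 x)
  exact ⟨g, fun x => congrFun hg x⟩

/-- Identification of the plane with `ℂ`. -/
noncomputable def Plane.toComplex : Plane ≃ₗᵢ[ℝ] ℂ := Complex.orthonormalBasisOneI.repr.symm

/-- A nonzero power of `z - c` has no continuous logarithm outside a bounded set. -/
lemma eq_zero_of_exp_eq_zpow {c : Plane} {r : ℝ} (hr : 0 < r) {k : ℤ} {L : Plane → ℂ}
    (hL : Continuous L) (h : ∀ z, dist z c = r →
      Complex.exp (L z) = (z.toComplex - c.toComplex) ^ k) : k = 0 := by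
  let z : ℝ → Plane := fun t =>
    Plane.toComplex.symm (c.toComplex + r * Complex.exp (t * Complex.I))
  have hz : Continuous z := by
    refine Plane.toComplex.symm.continuous.comp ?_
    fun_prop
  have hzc : ∀ t, (z t).toComplex = c.toComplex + r * Complex.exp (t * Complex.I) := fun t =>
    Plane.toComplex.apply_symm_apply _
  have hdist : ∀ t, dist (z t) c = r := by
    intro t
    rw [← Plane.toComplex.dist_map, hzc, dist_eq_norm, add_sub_cancel_left, norm_mul,
      Complex.norm_exp_ofReal_mul_I, mul_one, Complex.norm_real, Real.norm_of_nonneg hr.le]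
  -- Along the circle, `φ` has constant exponential `r ^ k`, so it is constant by unique lifting;
  -- comparing `0` with `2π` gives `2πik = 0`.
  let φ : ℝ → ℂ := fun t => L (z t) - k * (t * Complex.I)
  have hφ : Continuous φ := by
    have := hL.comp hz
    exact this.sub (by fun_prop)
  have hexp : ∀ t, Complex.exp (φ t) = (r : ℂ) ^ k := by
    intro t
    simp only [φ]
    rw [Complex.exp_sub, h _ (hdist t), hzc, add_sub_cancel_left, Complex.exp_int_mul, mul_zpow,
      mul_div_assoc, div_self (zpow_ne_zero _ (Complex.exp_ne_zero _)), mul_one]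
  have hconst : φ = fun _ => φ 0 :=
    Complex.isCoveringMap_exp.eq_of_comp_eq hφ continuous_const
      (by funext t; exact Subtype.ext ((hexp t).trans (hexp 0).symm)) 0 rfl
  have h1 := congrFun hconst (2 * Real.pi)
  have h2 : z (2 * Real.pi) = z 0 := by
    simp only [z]
    push_cast
    rw [Complex.exp_two_pi_mul_I]
    simp
  simp only [φ, h2, Complex.ofReal_zero, zero_mul, mul_zero, sub_zero, sub_eq_self] at h1
  simpa [Real.pi_ne_zero] using h1

lemma frontier_connectedComponentIn_compl_subset {X : Type*} [TopologicalSpace X]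
    [LocallyConnectedSpace X] {K : Set X} (hK : IsClosed K) (x : X) :
    frontier (connectedComponentIn Kᶜ x) ⊆ K := by
  intro z hz
  by_contra hzK
  have hopen : IsOpen (connectedComponentIn Kᶜ z) := hK.isOpen_compl.connectedComponentIn
  have hzmem : z ∈ connectedComponentIn Kᶜ z := mem_connectedComponentIn hzK
  obtain ⟨w, hw, hwx⟩ := mem_closure_iff.1 hz.1 _ hopen hzmem
  rw [(hK.isOpen_compl.connectedComponentIn (x := x)).frontier_eq] at hz
  exact hz.2 (connectedComponentIn_eq hwx ▸ connectedComponentIn_eq hw ▸ hzmem)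

/-- Eilenberg's criterion: if a product of powers of `z - p i` has a continuous logarithm on a
closed set `K`, then the exponent of a point `p i₀` that lies in a bounded component of the
complement of `K`, apart from the other points, vanishes. -/
theorem eq_zero_of_exp_eq_prod_zpow {K : Set Plane} (hK : IsClosed K) {ι : Type*} [Fintype ι]
    {p : ι → Plane} (hp : ∀ i, p i ∉ K) {i₀ : ι}
    (hsep : ∀ i, i ≠ i₀ → p i ∉ connectedComponentIn Kᶜ (p i₀))
    (hbdd : Bornology.IsBounded (connectedComponentIn Kᶜ (p i₀))) {k : ι → ℤ} {g : Plane → ℂ}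
    (hg : ContinuousOn g K)
    (hexp : ∀ z ∈ K, Complex.exp (g z) = ∏ i, (z.toComplex - (p i).toComplex) ^ k i) :
    k i₀ = 0 := by
  classical
  set U := connectedComponentIn Kᶜ (p i₀) with hU
  have hUo : IsOpen U := hK.isOpen_compl.connectedComponentIn
  have hp₀ : p i₀ ∈ U := mem_connectedComponentIn (hp i₀)
  have hfr : frontier U ⊆ K := frontier_connectedComponentIn_compl_subset hK _
  obtain ⟨g', hg'⟩ := ContinuousMap.exists_restrict_eq hK
    ⟨K.domRestrict g, continuousOn_iff_continuous_domRestrict.1 hg⟩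
  have hgg : ∀ z ∈ K, g' z = g z := fun z hz => congrArg (fun f : C(K, ℂ) => f ⟨z, hz⟩) hg'
  have hne : ∀ {i : ι} {z : Plane}, z ≠ p i → z.toComplex - (p i).toComplex ≠ 0 := by
    intro i z h
    exact sub_ne_zero.2 (fun e => h (Plane.toComplex.injective e))
  -- `A` inside `U` and `B` outside agree on the frontier, which lies in `K`. They glue to a
  -- function without zeros on the plane, which has a logarithm; on a circle around the bounded set
  -- `U` it equals `B`, a pure power.
  let A : Plane → ℂ := fun z =>
    Complex.exp (g' z) * ∏ i ∈ Finset.univ.erase i₀, (z.toComplex - (p i).toComplex) ^ (-k i)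
  let B : Plane → ℂ := fun z => (z.toComplex - (p i₀).toComplex) ^ k i₀
  have hcl : ∀ z ∈ closure U, ∀ i, i ≠ i₀ → z ≠ p i := by
    rintro z hz i hi rfl
    exact hp i (hfr ⟨hz, by rw [hUo.interior_eq]; exact hsep i hi⟩)
  have hA : ContinuousOn A (closure U) := by
    refine (Complex.continuous_exp.comp g'.continuous).continuousOn.mul ?_
    refine continuousOn_finsetProd _ fun i hi => ?_
    refine ContinuousOn.zpow₀ ?_ _ fun z hz => Or.inl (hne (hcl z hz i (Finset.ne_of_mem_erase hi)))
    exact (Plane.toComplex.continuous.sub continuous_const).continuousOn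
  have hB : ContinuousOn B Uᶜ := by
    refine ContinuousOn.zpow₀ ?_ _ fun z hz => Or.inl (hne (fun e => hz (e ▸ hp₀)))
    exact (Plane.toComplex.continuous.sub continuous_const).continuousOn
  have hAB : ∀ z ∈ K, A z = B z := by
    intro z hz
    simp only [A, B]
    rw [hgg z hz, hexp z hz, ← Finset.mul_prod_erase _ _ (Finset.mem_univ i₀), mul_assoc,
      ← Finset.prod_mul_distrib, Finset.prod_eq_one, mul_one]
    intro i _
    have : z ≠ p i := fun e => hp i (e ▸ hz)
    rw [← zpow_add₀ (hne this), add_neg_cancel, zpow_zero]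
  have hcont : Continuous (U.piecewise A B) := by
    rw [← continuousOn_univ]
    refine ContinuousOn.piecewise (fun z hz => hAB z (hfr hz.2)) ?_ ?_
    · simpa using hA
    · rw [hUo.isClosed_compl.closure_eq]
      simpa using hB
  have hnz : ∀ z, U.piecewise A B z ≠ 0 := by
    intro z
    by_cases hz : z ∈ U
    · rw [Set.piecewise_eq_of_mem _ _ _ hz]
      refine mul_ne_zero (Complex.exp_ne_zero _) (Finset.prod_ne_zero_iff.2 fun i hi => ?_)
      exact zpow_ne_zero _ (hne (hcl z (subset_closure hz) i (Finset.ne_of_mem_erase hi)))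
    · rw [Set.piecewise_eq_of_notMem _ _ _ hz]
      exact zpow_ne_zero _ (hne (fun e => hz (e ▸ hp₀)))
  obtain ⟨L, hL⟩ := exists_continuousMap_exp_eq hcont hnz
  obtain ⟨r, hr, hUr⟩ := hbdd.subset_ball_lt 0 (p i₀)
  refine eq_zero_of_exp_eq_zpow (c := p i₀) hr L.continuous fun z hz => ?_
  rw [hL, Set.piecewise_eq_of_notMem]
  intro hzU
  exact absurd (Metric.mem_ball.1 (hUr hzU)) (by rw [hz]; exact lt_irrefl r)

/-- A continuous function without zeros on an arc has a continuous logarithm. -/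
lemma exists_continuousMap_exp_eq_on_range {x y : Plane} (γ : Path x y)
    (hγ : Function.Injective γ) {f : Plane → ℂ} (hf : Continuous f)
    (h0 : ∀ z ∈ Set.range γ, f z ≠ 0) :
    ∃ g : C(Plane, ℂ), ∀ z ∈ Set.range γ, Complex.exp (g z) = f z := by
  obtain ⟨L, hL⟩ := exists_continuousMap_exp_eq (f := fun t : ℝ => f (γ.extend t))
    (hf.comp γ.continuous_extend) (fun t => h0 _ (by
      rw [← γ.extend_range]
      exact ⟨t, rfl⟩))
  have hemb : Topology.IsClosedEmbedding γ := γ.continuous.isClosedEmbedding hγ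
  obtain ⟨g, hg⟩ := ContinuousMap.exists_extension' hemb
    (⟨fun t => L t, L.continuous.comp continuous_subtype_val⟩ : C(unitInterval, ℂ))
  refine ⟨g, ?_⟩
  rintro _ ⟨t, rfl⟩
  have h1 : g (γ t) = L t := congrFun hg t
  rw [h1, hL, γ.extend_apply]

/-- The complement of a disc in the plane is connected. -/
lemma isPreconnected_compl_closedBall {r : ℝ} (hr : 0 ≤ r) :
    IsPreconnected (Metric.closedBall (0 : Plane) r)ᶜ := by
  have hrank : 1 < Module.rank ℝ Plane := by
    rw [← Module.finrank_eq_rank]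
    simp
  have h : (Metric.closedBall (0 : Plane) r)ᶜ =
      (fun q : ℝ × Plane => q.1 • q.2) '' (Set.Ioi r ×ˢ Metric.sphere (0 : Plane) 1) := by
    ext z
    constructor
    · intro hz
      have hz' : r < ‖z‖ := by simpa using hz
      have hz0 : ‖z‖ ≠ 0 := (hr.trans_lt hz').ne'
      exact ⟨(‖z‖, ‖z‖⁻¹ • z), ⟨hz', by simp [norm_smul, hz0]⟩, by simp [smul_smul, hz0]⟩
    · rintro ⟨⟨t, w⟩, ⟨ht, hw⟩, rfl⟩
      have ht' : r < t := ht
      have hw' : ‖w‖ = 1 := by simpa using hw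
      simp [norm_smul, hw', abs_of_pos (hr.trans_lt ht'), ht']
  rw [h]
  exact (isPreconnected_Ioi.prod (isPreconnected_sphere hrank 0 1)).image _
    (by fun_prop)

/-! ### Half of Euler's formula for drawings -/

namespace PlaneDrawing

variable {V : Type*} {G : SimpleGraph V}

lemma isClosed_arc (D : PlaneDrawing G) (e : G.edgeSet) : IsClosed (D.arc e) := by
  obtain ⟨e, he⟩ := e
  induction e using Sym2.ind with
  | _ u v =>
    obtain ⟨γ, -, hγ⟩ := D.arc_isArc u v he
    rw [← hγ]
    exact (isCompact_range γ.continuous).isClosed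

lemma isBounded_arc (D : PlaneDrawing G) (e : G.edgeSet) : Bornology.IsBounded (D.arc e) := by
  obtain ⟨e, he⟩ := e
  induction e using Sym2.ind with
  | _ u v =>
    obtain ⟨γ, -, hγ⟩ := D.arc_isArc u v he
    rw [← hγ]
    exact (isCompact_range γ.continuous).isBounded

lemma isClosed_support [Finite V] (D : PlaneDrawing G) : IsClosed D.support :=
  (Set.finite_range D.point).isClosed.union (isClosed_iUnion_of_finite D.isClosed_arc)

lemma isBounded_support [Finite V] (D : PlaneDrawing G) : Bornology.IsBounded D.support :=
  (Set.finite_range D.point).isBounded.union (Bornology.isBounded_iUnion.2 D.isBounded_arc)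

/-- If continuous functions on the arcs of a drawing agree with given values at the ends of the
arcs, then they can be glued to one function on the drawing. -/
lemma exists_continuousOn_support [Finite V] (D : PlaneDrawing G) (h : V → ℂ)
    (g : G.edgeSet → C(Plane, ℂ)) (hgh : ∀ e : G.edgeSet, ∀ w ∈ (e : Sym2 V), g e (D.point w) = h w) :
    ∃ f : Plane → ℂ, ContinuousOn f D.support ∧ (∀ w, f (D.point w) = h w) ∧
      ∀ e, Set.EqOn f (g e) (D.arc e) := by
  classical
  let f : Plane → ℂ := fun x => if hx : ∃ w, D.point w = x then h hx.choose else
    if hx : ∃ e, x ∈ D.arc e then g hx.choose x else 0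
  have hf : ∀ w, f (D.point w) = h w := by
    intro w
    have hx : ∃ w', D.point w' = D.point w := ⟨w, rfl⟩
    simp only [f, dif_pos hx]
    rw [D.point_injective hx.choose_spec]
  have hfe : ∀ e, Set.EqOn f (g e) (D.arc e) := by
    intro e x hx
    by_cases hw : ∃ w, D.point w = x
    · obtain ⟨w, rfl⟩ := hw
      rw [hf, hgh e w (D.mem_of_point_mem_arc w e hx)]
    · have hex : ∃ e, x ∈ D.arc e := ⟨e, hx⟩
      simp only [f, dif_neg hw, dif_pos hex]
      by_cases hee : hex.choose = e
      · rw [hee]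
      · obtain ⟨w, -, hw'⟩ := D.arc_inter_arc _ _ hee ⟨hex.choose_spec, hx⟩
        exact absurd ⟨w, hw'⟩ hw
  refine ⟨f, ?_, hf, hfe⟩
  have hsupp : D.support = ⋃ i : V ⊕ G.edgeSet, Sum.elim (fun v => {D.point v}) D.arc i := by
    rw [Set.iUnion_sum]
    simp only [Sum.elim_inl, Sum.elim_inr, Set.iUnion_singleton_eq_range]
    rfl
  rw [hsupp]
  refine (locallyFinite_of_finite _).continuousOn_iUnion ?_ ?_
  · rintro (v | e)
    · exact isClosed_singleton
    · exact D.isClosed_arc e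
  · rintro (v | e)
    · exact continuousOn_singleton _ _
    · exact (g e).continuous.continuousOn.congr (hfe e)

/-- An arc of a drawing contains its two ends, and nonvanishing continuous functions have continuous
logarithms on it. -/
lemma exists_log_arc (D : PlaneDrawing G) (e : G.edgeSet) : ∃ u v : V, (e : Sym2 V) = s(u, v) ∧
    D.point u ∈ D.arc e ∧ D.point v ∈ D.arc e ∧
    ∀ f : Plane → ℂ, Continuous f → (∀ z ∈ D.arc e, f z ≠ 0) →
      ∃ g : C(Plane, ℂ), ∀ z ∈ D.arc e, Complex.exp (g z) = f z := by
  obtain ⟨e, he⟩ := e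
  induction e using Sym2.ind with
  | _ u v =>
    obtain ⟨γ, hinj, hγ⟩ := D.arc_isArc u v he
    refine ⟨u, v, rfl, hγ ▸ ⟨0, γ.source⟩, hγ ▸ ⟨1, γ.target⟩, fun f hf h0 => ?_⟩
    rw [← hγ] at h0 ⊢
    exact exists_continuousMap_exp_eq_on_range γ hinj hf h0

/-- More functions `z - p i` than the first Betti number of the graph are multiplicatively dependent
modulo functions on the drawing that have a continuous logarithm. -/
theorem exists_exp_eq_prod_zpow [Finite V] (hG : G.Connected) (D : PlaneDrawing G) {ι : Type*}
    [Fintype ι] {p : ι → Plane} (hp : ∀ i, p i ∉ D.support)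
    (hcard : G.edgeSet.ncard + 1 < Fintype.card ι + Nat.card V) :
    ∃ k : ι → ℤ, k ≠ 0 ∧ ∃ g : Plane → ℂ, ContinuousOn g D.support ∧
      ∀ z ∈ D.support, Complex.exp (g z) = ∏ i, (z.toComplex - (p i).toComplex) ^ k i := by
  classical
  have := Fintype.ofFinite V
  have := Fintype.ofFinite G.edgeSet
  obtain ⟨r⟩ := hG.nonempty
  choose a b hab haD hbD hlog using D.exists_log_arc
  have hne : ∀ i, ∀ z ∈ D.support, z.toComplex - (p i).toComplex ≠ 0 := by
    intro i z hz
    exact sub_ne_zero.2 (fun h => hp i (Plane.toComplex.injective h ▸ hz))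
  have harc : ∀ e, D.arc e ⊆ D.support := fun e =>
    (Set.subset_iUnion D.arc e).trans Set.subset_union_right
  have hpt : ∀ v, D.point v ∈ D.support := fun v => Or.inl ⟨v, rfl⟩
  let l : ι → V → ℂ := fun i v => Complex.log ((D.point v).toComplex - (p i).toComplex)
  have hl : ∀ i v, Complex.exp (l i v) = (D.point v).toComplex - (p i).toComplex := fun i v =>
    Complex.exp_log (hne i _ (hpt v))
  -- On each arc the logarithm is normalised to match the chosen vertex value at one end; `c`
  -- records its mismatch at the other, in units of `2πi`.
  have hlam : ∀ i e, ∃ (g : C(Plane, ℂ)) (c : ℤ),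
      (∀ z ∈ D.arc e, Complex.exp (g z) = z.toComplex - (p i).toComplex) ∧
      g (D.point (a e)) = l i (a e) ∧
      g (D.point (b e)) = l i (b e) + c * (2 * Real.pi * Complex.I) := by
    intro i e
    obtain ⟨g, hg⟩ := hlog e (fun z => z.toComplex - (p i).toComplex)
      (Plane.toComplex.continuous.sub continuous_const) (fun z hz => hne i z (harc e hz))
    obtain ⟨m, hm⟩ := Complex.exp_eq_exp_iff_exists_int.1 ((hg _ (haD e)).trans (hl i (a e)).symm)
    obtain ⟨n, hn⟩ := Complex.exp_eq_exp_iff_exists_int.1 ((hg _ (hbD e)).trans (hl i (b e)).symm)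
    refine ⟨g - ContinuousMap.const _ (m * (2 * Real.pi * Complex.I)), n - m, ?_, ?_, ?_⟩
    · intro z hz
      rw [ContinuousMap.sub_apply, ContinuousMap.const_apply, Complex.exp_sub, hg z hz,
        Complex.exp_int_mul_two_pi_mul_I, div_one]
    · rw [ContinuousMap.sub_apply, ContinuousMap.const_apply, hm]
      ring
    · rw [ContinuousMap.sub_apply, ContinuousMap.const_apply, hn]
      push_cast
      ring
  choose lam c hlam hlama hlamb using hlam
  -- The unknowns are the exponents `k i` and shifts `d v` of the vertex logarithms by multiples of
  -- `2πi`. The edge coordinates vanish when the logarithms of the product match at both ends of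
  -- every arc; the extra coordinate pins `d` at the root `r`, so that `k = 0` forces `d = 0`.
  let M : (ι ⊕ V → ℤ) →ₗ[ℤ] (G.edgeSet ⊕ Unit → ℤ) :=
    { toFun := fun x => Sum.elim
        (fun e => ∑ i, x (Sum.inl i) * c i e - (x (Sum.inr (b e)) - x (Sum.inr (a e))))
        (fun _ => x (Sum.inr r))
      map_add' := by
        intro x y
        funext j
        rcases j with e | _
        · simp only [Sum.elim_inl, Pi.add_apply, add_mul, Finset.sum_add_distrib]
          ring
        · simp
      map_smul' := by
        intro t x
        funext j
        rcases j with e | _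
        · simp only [Sum.elim_inl, Pi.smul_apply, smul_eq_mul, RingHom.id_apply, mul_sub,
            Finset.mul_sum, mul_assoc]
        · simp }
  have hM : ¬ Function.Injective M := by
    intro hinj
    have h1 := card_le_of_injective ℤ M hinj
    rw [Fintype.card_sum, Fintype.card_sum, Fintype.card_unit, ← Nat.card_eq_fintype_card (α := V),
      ← Nat.card_eq_fintype_card (α := G.edgeSet), Nat.card_coe_set_eq] at h1
    omega
  rw [injective_iff_map_eq_zero] at hM
  push Not at hM
  obtain ⟨x, hx, hx0⟩ := hM
  have hxe : ∀ e, ∑ i, x (Sum.inl i) * c i e = x (Sum.inr (b e)) - x (Sum.inr (a e)) := fun e =>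
    sub_eq_zero.1 (congrFun hx (Sum.inl e))
  have hxr : x (Sum.inr r) = 0 := congrFun hx (Sum.inr ())
  let k : ι → ℤ := fun i => x (Sum.inl i)
  let d : V → ℤ := fun v => x (Sum.inr v)
  refine ⟨k, ?_, ?_⟩
  · intro hk
    have hk' : ∀ i, x (Sum.inl i) = 0 := fun i => congrFun hk i
    have hadj : ∀ u v, G.Adj u v → d u = d v := by
      intro u v huv
      have h1 := hxe ⟨s(u, v), huv⟩
      have h2 := hab ⟨s(u, v), huv⟩
      simp only [hk', zero_mul, Finset.sum_const_zero] at h1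
      rcases Sym2.eq_iff.1 h2 with ⟨h3, h4⟩ | ⟨h3, h4⟩
      · rw [← h3, ← h4] at h1
        exact (sub_eq_zero.1 h1.symm).symm
      · rw [← h3, ← h4] at h1
        exact sub_eq_zero.1 h1.symm
    have hd : ∀ v, d v = 0 := by
      intro v
      have := hG.preconnected r v
      rw [SimpleGraph.reachable_iff_reflTransGen] at this
      induction this with
      | refl => exact hxr
      | tail _ h ih => rw [← hadj _ _ h, ih]
    apply hx0
    funext j
    rcases j with i | v
    · exact hk' i
    · exact hd v
  · let h : V → ℂ := fun v => ∑ i, k i * l i v + d v * (2 * Real.pi * Complex.I)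
    let g : G.edgeSet → C(Plane, ℂ) := fun e =>
      ⟨fun z => ∑ i, k i * lam i e z + d (a e) * (2 * Real.pi * Complex.I), by fun_prop⟩
    have hgh : ∀ e : G.edgeSet, ∀ w ∈ (e : Sym2 V), g e (D.point w) = h w := by
      intro e w hw
      rw [hab e] at hw
      rcases Sym2.mem_iff.1 hw with rfl | rfl
      · simp only [g, h, ContinuousMap.coe_mk, hlama]
      · have h1 : (∑ i, (k i : ℂ) * c i e) = d (b e) - d (a e) := by exact_mod_cast hxe e
        simp only [g, h, ContinuousMap.coe_mk, hlamb, mul_add, Finset.sum_add_distrib]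
        simp only [← mul_assoc, ← Finset.sum_mul, h1]
        ring
    obtain ⟨f, hfc, hfpt, hfarc⟩ := D.exists_continuousOn_support h g hgh
    refine ⟨f, hfc, ?_⟩
    rintro z (⟨w, rfl⟩ | hz)
    · rw [hfpt]
      simp only [h]
      rw [Complex.exp_add, Complex.exp_int_mul_two_pi_mul_I, mul_one, Complex.exp_sum]
      exact Finset.prod_congr rfl fun i _ => by rw [Complex.exp_int_mul, hl]
    · obtain ⟨e, hz⟩ := Set.mem_iUnion.1 hz
      rw [hfarc e hz]
      simp only [g, ContinuousMap.coe_mk]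
      rw [Complex.exp_add, Complex.exp_int_mul_two_pi_mul_I, mul_one, Complex.exp_sum]
      exact Finset.prod_congr rfl fun i _ => by rw [Complex.exp_int_mul, hlam i e z hz]

/-- One half of Euler's formula. -/
theorem numRegions_add_card_le [Finite V] (hG : G.Connected) (D : PlaneDrawing G) :
    D.numRegions + Nat.card V ≤ G.edgeSet.ncard + 2 := by
  classical
  by_contra! hlt
  have hEV := hG.card_vert_le_card_edgeSet_add_one
  rw [Nat.card_coe_set_eq] at hEV
  have hF : Nat.card (ConnectedComponents ↥(D.support)ᶜ) = D.numRegions := rfl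
  -- `Nat.card` of an infinite type is `0`, but the negated bound together with `V ≤ E + 1` makes
  -- the number of regions positive.
  have : Finite (ConnectedComponents ↥(D.support)ᶜ) :=
    Nat.finite_of_card_ne_zero (by omega)
  have := Fintype.ofFinite (ConnectedComponents ↥(D.support)ᶜ)
  choose q hq using ConnectedComponents.surjective_coe (α := ↥(D.support)ᶜ)
  let U : ConnectedComponents ↥(D.support)ᶜ → Set Plane := fun c =>
    connectedComponentIn (D.support)ᶜ (q c)
  have hU : ∀ c (z : ↥(D.support)ᶜ), z.1 ∈ U c → (z : ConnectedComponents ↥(D.support)ᶜ) = c := by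
    intro c z hz
    simp only [U] at hz
    rw [connectedComponentIn_eq_image (q c).2] at hz
    obtain ⟨w, hw, hwz⟩ := hz
    rw [← Subtype.ext hwz, ← hq c]
    exact ConnectedComponents.coe_eq_coe'.2 hw
  obtain ⟨r, hr, hKr⟩ := D.isBounded_support.subset_closedBall_lt 0 0
  have hunb : ∀ c, ¬ Bornology.IsBounded (U c) → ∃ z, z ∉ Metric.closedBall (0 : Plane) r ∧
      z ∈ U c := by
    intro c hc
    by_contra! h
    exact hc (Metric.isBounded_closedBall.subset fun z hz => by
      by_contra hz'
      exact h z hz' hz)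
  -- Every unbounded region meets the connected complement of a disc that contains the drawing, so
  -- there is at most one.
  have honly : ∀ c c', ¬ Bornology.IsBounded (U c) → ¬ Bornology.IsBounded (U c') → c = c' := by
    intro c c' hc hc'
    obtain ⟨z, hz, hzc⟩ := hunb c hc
    obtain ⟨w, hw, hwc⟩ := hunb c' hc'
    have hsub : (Metric.closedBall (0 : Plane) r)ᶜ ⊆ (D.support)ᶜ := Set.compl_subset_compl.2 hKr
    have h1 := (isPreconnected_compl_closedBall hr.le).subset_connectedComponentIn hz hsub hw
    rw [← connectedComponentIn_eq hzc] at h1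
    rw [← hU c ⟨w, hsub hw⟩ h1, ← hU c' ⟨w, hsub hw⟩ hwc]
  let ι := {c // Bornology.IsBounded (U c)}
  have hι : D.numRegions ≤ Fintype.card ι + 1 := by
    rw [← hF, Nat.card_eq_fintype_card]
    have h1 := Fintype.card_subtype_compl (fun c => Bornology.IsBounded (U c))
    have h2 : Fintype.card {c // ¬ Bornology.IsBounded (U c)} ≤ 1 :=
      Fintype.card_le_one_iff.2 fun c c' => Subtype.ext (honly _ _ c.2 c'.2)
    rw [h1] at h2
    exact Nat.sub_le_iff_le_add'.1 h2
  obtain ⟨k, hk, g, hg, hexp⟩ := D.exists_exp_eq_prod_zpow hG (p := fun i : ι => (q i.1).1)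
    (fun i => (q i.1).2) (by omega)
  apply hk
  funext i
  refine eq_zero_of_exp_eq_prod_zpow D.isClosed_support (p := fun i : ι => (q i.1).1)
    (fun i => (q i.1).2) (i₀ := i) (fun j hj h => hj ?_) i.2 hg hexp
  exact Subtype.ext ((hq j.1).symm.trans (hU i.1 (q j.1) h))

end PlaneDrawing

theorem corollary3p2p2 {V : Type*} [Finite V] (G : SimpleGraph V) (hG : G.Connected)
    (D : PlaneDrawing G) (hC : G.inducedCycles.ncard ≤ D.numRegions + 2) :
    G.chromaticNumber ≤ 4 := by
  by_contra h
  have h1 := SimpleGraph.ncard_edgeSet_add_five_le hG fun hcol =>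
    h (SimpleGraph.chromaticNumber_le_iff_colorable.2 hcol)
  have h2 := D.numRegions_add_card_le hG
  omega
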